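/- Let $(\alpha_l)_{l\ge 0}$ be a sequence of real numbers and let $(\beta_l)_{l\ge0}$, $(\gamma_l)_{l\ge0}$, $(\rho_l)_{l\ge0}$ be sequences of positive numbers. Let $P_l$ be the polynomials given by $$\gamma_{l-1}P_{l-1}(\lambda)+\alpha_lP_l(\lambda)+\beta_lP_{l+1}(\lambda)=\lambda\rho_lP_l(\lambda)\quad(l\ge0),\qquad P_{-1}=0,\quad P_0=1$$ (the value $\gamma_{-1}>0$ is immaterial), and let $d_0=\rho_0$ and $d_l=\rho_l\,\dfrac{\beta_0\cdots\beta_{l-1}}{\gamma_0\cdots\gamma_{l-1}}$ for $l\ge1$. Let $q\ge1$ and $0\le m\le q$ be integers and let $\eta\in\mathbb{R}$. Then the polynomial $\widetilde P_{q+1}(\lambda)=P_{q+1}(\lambda)-\eta P_q(\lambda)$ has exactly $q+1$ distinct real zeros $\lambda_{q+1}<\dots<\lambda_1$, and there is an expansion $$\frac{\widetilde P_{q+1}(\lambda)}{(\lambda-\lambda_1)\cdots(\lambda-\lambda_{m+1})}=\sum_{l=0}^{q-m}d_l\,a_l\,P_l(\lambda)$$ with real coefficients $a_0,\dots,a_{q-m}$.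 Let $(a,b)$ be a bounded open interval containing all the zeros of $P_q$, and let $\eta_b=P_{q+1}(b)/P_q(b)$. Then the coefficients of this expansion satisfy the following. (a) If either $m\ge1$ (and $\eta\in\mathbb{R}$ is arbitrary), or $m=0$ and $\eta<\eta_b$, then $$\frac{a_0}{P_0(b)}>\frac{a_1}{P_1(b)}>\cdots>\frac{a_{q-m}}{P_{q-m}(b)}>0.$$ (b) If $m=0$ and $\eta=\eta_b$, then $$\frac{a_0}{P_0(b)}=\frac{a_1}{P_1(b)}=\cdots=\frac{a_q}{P_q(b)}>0.$$ (c) If $m=0$ and $\eta>\eta_b$, then $$0<\frac{a_0}{P_0(b)}<\frac{a_1}{P_1(b)}<\cdots<\frac{a_q}{P_q(b)}.$$ -/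

import Mathlib

open Polynomial

noncomputable section

/-- The polynomials `P_l` (`l = 0, 1, 2, …`) solving
`γ_{l-1} P_{l-1} + α_l P_l + β_l P_{l+1} = λ ρ_l P_l`, `P_{-1} = 0`, `P_0 = 1`. -/
def jacobiPoly (α β γ ρ : ℕ → ℝ) : ℕ → ℝ[X]
  | 0 => 1
  | 1 => C (β 0)⁻¹ * (C (ρ 0) * X - C (α 0))
  | l + 2 => C (β (l + 1))⁻¹ *
      ((C (ρ (l + 1)) * X - C (α (l + 1))) * jacobiPoly α β γ ρ (l + 1)
        - C (γ l) * jacobiPoly α β γ ρ l)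

/-- The normalizing constants `d_l = ρ_l (β_0 ⋯ β_{l-1}) / (γ_0 ⋯ γ_{l-1})`, `d_0 = ρ_0`. -/
def jacobiNorm (β γ ρ : ℕ → ℝ) (l : ℕ) : ℝ :=
  ρ l * ((∏ i ∈ Finset.range l, β i) / ∏ i ∈ Finset.range l, γ i)

/-- The polynomial `P_{q+1} - η P_q`. -/
def perturbedPoly (α β γ ρ : ℕ → ℝ) (q : ℕ) (η : ℝ) : ℝ[X] :=
  jacobiPoly α β γ ρ (q + 1) - C η * jacobiPoly α β γ ρ q

/-- `z 1 > z 2 > ⋯ > z n` are exactly the real zeros of `p`. -/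
def IsDecreasingZeros (p : ℝ[X]) (n : ℕ) (z : ℕ → ℝ) : Prop :=
  StrictAntiOn z (Set.Icc 1 n) ∧ {x : ℝ | p.IsRoot x} = z '' Set.Icc 1 n

/-- The numbers `a 0, …, a (q - m)` are the coefficients of the expansion
`(P_{q+1} - η P_q) / ((λ - z_1) ⋯ (λ - z_{m+1})) = ∑_{l=0}^{q-m} d_l a_l P_l`
(for `m ≤ q`), as an identity of polynomials with the denominator multiplied out. -/
def IsQuotientExpansion (α β γ ρ : ℕ → ℝ) (q m : ℕ) (η : ℝ) (z a : ℕ → ℝ) : Prop :=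
  perturbedPoly α β γ ρ q η =
    (∏ j ∈ Finset.Icc 1 (m + 1), (X - C (z j))) *
      ∑ l ∈ Finset.range (q - m + 1), C (jacobiNorm β γ ρ l * a l) * jacobiPoly α β γ ρ l

/-- The recurrence at `l = 0`. -/
theorem jacobiPoly_rec_zero (α β γ ρ : ℕ → ℝ) (hβ : ∀ l, 0 < β l) :
    C (α 0) * jacobiPoly α β γ ρ 0 + C (β 0) * jacobiPoly α β γ ρ 1
      = X * C (ρ 0) * jacobiPoly α β γ ρ 0 := by
  have h : C (β 0) * C (β 0)⁻¹ = (1 : ℝ[X]) := by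
    rw [← C_mul, mul_inv_cancel₀ (hβ 0).ne', C_1]
  simp only [jacobiPoly]
  linear_combination (C (ρ 0) * X - C (α 0)) * h

/-- The recurrence at `l + 1`. -/
theorem jacobiPoly_rec_succ (α β γ ρ : ℕ → ℝ) (hβ : ∀ l, 0 < β l) (l : ℕ) :
    C (γ l) * jacobiPoly α β γ ρ l + C (α (l + 1)) * jacobiPoly α β γ ρ (l + 1)
        + C (β (l + 1)) * jacobiPoly α β γ ρ (l + 2)
      = X * C (ρ (l + 1)) * jacobiPoly α β γ ρ (l + 1) := by
  have h : C (β (l + 1)) * C (β (l + 1))⁻¹ = (1 : ℝ[X]) := by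
    rw [← C_mul, mul_inv_cancel₀ (hβ (l + 1)).ne', C_1]
  rw [jacobiPoly]
  linear_combination ((C (ρ (l + 1)) * X - C (α (l + 1))) * jacobiPoly α β γ ρ (l + 1)
        - C (γ l) * jacobiPoly α β γ ρ l) * h

end

/-! Replacing `α_q` by `α_q + β_q η` leaves `P_0, …, P_q` unchanged and turns `P_{q+1}` into
`P_{q+1} - η P_q`. So one may work with an unperturbed `P_{q+1}`; the number `η_b - η` survives as
the sign of the new `P_{q+1}(b)`. The Christoffel–Darboux formula gives real simple zeros and Gauss
weights for which `P_0, …, P_q` are orthogonal on the zeros of `P_{q+1}`.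

For `m = 0` the quotient by `λ - λ_1` is a multiple of the Christoffel–Darboux kernel at `λ_1`, so
`a_l` is proportional to `P_l(λ_1)`. The same formula at level `l` shows that the consecutive
differences of `P_l(λ_1)/P_l(b)` have the sign of `b - λ_1`, which is that of `P_{q+1}(b)`
(`quotient_coeff_largest_zero`).

For `m ≥ 1` the quotient is a positive multiple of the product of `X - x` over the smallest zeros.
If this product is `∑ E_l K_l`, with `K_l` the kernel polynomials at `b`, then `a_l / P_l(b)` is a
positive constant times the tail `∑_{i ≥ l} E_i`; hence it suffices that all `E_l > 0`. The `K_l`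
are orthogonal for `(b - x) w(x)`, which need not be positive at `λ_1`. A second Christoffel
transform, at `λ_1`, removes that node, and the remaining weights are positive because the other
zeros lie below `b`. There `IsOrthSystem.exists_pos_expansion` applies, by removing the largest node
repeatedly, and positivity passes back to the `K_l` (`exists_pos_kernel_expansion`). -/

/-- The bilinear form `(f, g) ↦ ∑_{x ∈ s} w(x) f(x) g(x)` on polynomials. -/
noncomputable def discreteForm (s : Finset ℝ) (w : ℝ → ℝ) (f g : ℝ[X]) : ℝ :=
  ∑ x ∈ s, w x * (f.eval x * g.eval x)

/-! ### Bilinearity of weighted sums over finitely many nodes -/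

section discreteForm

variable (s : Finset ℝ) (w : ℝ → ℝ)

theorem discreteForm_comm (f g : ℝ[X]) : discreteForm s w f g = discreteForm s w g f := by
  simp only [discreteForm, mul_comm (eval _ f)]

theorem discreteForm_sum_right {ι : Type*} (t : Finset ι) (f : ℝ[X]) (g : ι → ℝ[X]) :
    discreteForm s w f (∑ i ∈ t, g i) = ∑ i ∈ t, discreteForm s w f (g i) := by
  simp only [discreteForm, eval_finsetSum, Finset.mul_sum]
  exact Finset.sum_comm

theorem discreteForm_sum_left {ι : Type*} (t : Finset ι) (f : ι → ℝ[X]) (g : ℝ[X]) :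
    discreteForm s w (∑ i ∈ t, f i) g = ∑ i ∈ t, discreteForm s w (f i) g := by
  rw [discreteForm_comm, discreteForm_sum_right]
  exact Finset.sum_congr rfl fun i _ => discreteForm_comm s w _ _

theorem discreteForm_C_mul_right (c : ℝ) (f g : ℝ[X]) :
    discreteForm s w f (C c * g) = c * discreteForm s w f g := by
  simp only [discreteForm, eval_mul, eval_C, Finset.mul_sum]
  exact Finset.sum_congr rfl fun x _ => by ring

theorem discreteForm_C_mul_left (c : ℝ) (f g : ℝ[X]) :
    discreteForm s w (C c * f) g = c * discreteForm s w f g := by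
  rw [discreteForm_comm, discreteForm_C_mul_right, discreteForm_comm]

theorem discreteForm_add_right (f g h : ℝ[X]) :
    discreteForm s w f (g + h) = discreteForm s w f g + discreteForm s w f h := by
  simp only [discreteForm, eval_add, mul_add, Finset.sum_add_distrib]

theorem discreteForm_sub_mul (y : ℝ) (f g : ℝ[X]) :
    discreteForm s (fun x => (y - x) * w x) f g = discreteForm s w f ((C y - X) * g) := by
  simp only [discreteForm, eval_mul, eval_sub, eval_C, eval_X]
  exact Finset.sum_congr rfl fun x _ => by ring

end discreteForm

/-! ### Orthogonal systems on a finite set of nodes -/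

/-- `p 0, …, p (N - 1)` have degrees `0, …, N - 1` and positive leading coefficients, and are
orthogonal for the discrete form with nodes `s` and weights `w`. -/
structure IsOrthSystem (s : Finset ℝ) (w : ℝ → ℝ) (p : ℕ → ℝ[X]) (N : ℕ) : Prop where
  natDegree_eq : ∀ l < N, (p l).natDegree = l
  leadingCoeff_pos : ∀ l < N, 0 < (p l).leadingCoeff
  orth : ∀ l < N, ∀ i < l, discreteForm s w (p l) (p i) = 0

theorem exists_expansion {p : ℕ → ℝ[X]} {N : ℕ} (hd : ∀ l < N, (p l).natDegree = l)
    (hl : ∀ l < N, 0 < (p l).leadingCoeff) :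
    ∀ k ≤ N, ∀ f : ℝ[X], f.degree < k → ∃ c : ℕ → ℝ, f = ∑ l ∈ Finset.range k, C (c l) * p l := by
  intro k
  induction k with
  | zero =>
    intro _ f hf
    refine ⟨0, ?_⟩
    simpa using hf
  | succ k ih =>
    intro hk f hf
    have hlk := hl k (by omega)
    have hdk := hd k (by omega)
    obtain ⟨c, hc⟩ := ih (by omega) (f - C (f.coeff k / (p k).leadingCoeff) * p k) (by
      rw [degree_lt_iff_coeff_zero] at hf ⊢
      intro i hi
      rcases hi.eq_or_lt with rfl | hi
      · have : (p k).coeff k = (p k).leadingCoeff := by rw [leadingCoeff, hdk]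
        rw [coeff_sub, coeff_C_mul, this, div_mul_cancel₀ _ hlk.ne', sub_self]
      · rw [coeff_sub, coeff_C_mul, hf i hi,
          coeff_eq_zero_of_natDegree_lt (show (p k).natDegree < i by omega)]
        simp)
    refine ⟨fun l => if l = k then f.coeff k / (p k).leadingCoeff else c l, ?_⟩
    simp only [Finset.sum_range_succ, if_true]
    rw [← sub_eq_iff_eq_add, hc]
    refine Finset.sum_congr rfl fun l hl => ?_
    rw [if_neg (Finset.mem_range.1 hl).ne]

/-- A polynomial with positive leading coefficient and no zeros in `[y, ∞)` is positive at `y`. -/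
theorem eval_pos_of_forall_not_isRoot {p : ℝ[X]} (hp : 0 < p.leadingCoeff) {y : ℝ}
    (h : ∀ x, y ≤ x → ¬ p.IsRoot x) : 0 < p.eval y := by
  refine zero_lt_eval_of_roots_lt_of_leadingCoeff_nonneg (fun x hx => ?_) hp.le
  by_contra hxy
  exact h x (not_lt.1 hxy) hx

namespace IsOrthSystem

variable {s : Finset ℝ} {w : ℝ → ℝ} {p : ℕ → ℝ[X]} {N : ℕ}

theorem mono (h : IsOrthSystem s w p N) {M : ℕ} (hM : M ≤ N) : IsOrthSystem s w p M :=
  ⟨fun l hl => h.1 l (hl.trans_le hM), fun l hl => h.2 l (hl.trans_le hM),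
    fun l hl => h.3 l (hl.trans_le hM)⟩

theorem ne_zero (h : IsOrthSystem s w p N) {l : ℕ} (hl : l < N) : p l ≠ 0 :=
  leadingCoeff_ne_zero.1 (h.2 l hl).ne'

theorem degree_eq (h : IsOrthSystem s w p N) {l : ℕ} (hl : l < N) : (p l).degree = l := by
  rw [degree_eq_natDegree (h.ne_zero hl), h.1 l hl]

theorem orth_of_ne (h : IsOrthSystem s w p N) {l i : ℕ} (hl : l < N) (hi : i < N) (hli : l ≠ i) :
    discreteForm s w (p l) (p i) = 0 := by
  rcases hli.lt_or_gt with h1 | h1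
  · rw [discreteForm_comm]; exact h.3 i hi l h1
  · exact h.3 l hl i h1

theorem orth_of_degree_lt (h : IsOrthSystem s w p N) {l : ℕ} (hl : l < N) {f : ℝ[X]}
    (hf : f.degree < l) : discreteForm s w (p l) f = 0 := by
  obtain ⟨c, rfl⟩ := exists_expansion h.1 h.2 l hl.le f hf
  rw [discreteForm_sum_right]
  refine Finset.sum_eq_zero fun i hi => ?_
  rw [discreteForm_C_mul_right, h.3 l hl i (Finset.mem_range.1 hi), mul_zero]

theorem form_sum (h : IsOrthSystem s w p N) {k i : ℕ} (hk : k ≤ N) (hi : i < k) (c : ℕ → ℝ) :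
    discreteForm s w (p i) (∑ l ∈ Finset.range k, C (c l) * p l)
      = c i * discreteForm s w (p i) (p i) := by
  rw [discreteForm_sum_right, Finset.sum_eq_single i]
  · rw [discreteForm_C_mul_right]
  · intro l hl hli
    rw [discreteForm_C_mul_right,
      h.orth_of_ne (by omega) ((Finset.mem_range.1 hl).trans_le hk) hli.symm, mul_zero]
  · intro hn; exact absurd (Finset.mem_range.2 hi) hn

/-- A nonzero polynomial of degree below the number of nodes cannot vanish at every node; this is
where `N ≤ s.card` enters. -/
theorem form_self_pos (h : IsOrthSystem s w p N) (hw : ∀ x ∈ s, 0 < w x) (hN : N ≤ s.card)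
    {l : ℕ} (hl : l < N) : 0 < discreteForm s w (p l) (p l) := by
  have hnn : ∀ x ∈ s, 0 ≤ w x * ((p l).eval x * (p l).eval x) := fun x hx =>
    mul_nonneg (hw x hx).le (mul_self_nonneg _)
  refine lt_of_le_of_ne (Finset.sum_nonneg hnn) fun h0 => h.ne_zero hl ?_
  have hz := (Finset.sum_eq_zero_iff_of_nonneg hnn).1 h0.symm
  refine eq_zero_of_degree_lt_of_eval_finset_eq_zero s ?_ fun x hx => ?_
  · rw [h.degree_eq hl]; exact_mod_cast hl.trans_le hN
  · simpa [(hw x hx).ne'] using hz x hx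

/-- A zero `r ≥ y` would give `p_l = (X - r) g` with `⟨p_l, g⟩ = 0`. Every term `w(x) (x - r) g(x)²`
is nonpositive, so all vanish and `p_l` has too many zeros. -/
theorem eval_pos (h : IsOrthSystem s w p N) (hw : ∀ x ∈ s, 0 < w x) (hN : N ≤ s.card) {y : ℝ}
    (hy : ∀ x ∈ s, x ≤ y) {l : ℕ} (hl : l < N) : 0 < (p l).eval y := by
  refine eval_pos_of_forall_not_isRoot (h.2 l hl) fun r hr hroot => ?_
  obtain ⟨g, hg⟩ := dvd_iff_isRoot.2 hroot
  have hg0 : g ≠ 0 := fun h0 => h.ne_zero hl (by rw [hg, h0, mul_zero])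
  have hdeg : g.degree < l := by
    rw [← h.degree_eq hl, hg, degree_mul, degree_X_sub_C, degree_eq_natDegree hg0]
    exact_mod_cast Nat.lt_add_of_pos_left Nat.one_pos
  have horth := h.orth_of_degree_lt hl hdeg
  have hnp : ∀ x ∈ s, w x * ((p l).eval x * g.eval x) ≤ 0 := fun x hx => by
    rw [hg, eval_mul, eval_sub, eval_X, eval_C, mul_assoc]
    exact mul_nonpos_of_nonneg_of_nonpos (hw x hx).le
      (mul_nonpos_of_nonpos_of_nonneg (by linarith [hy x hx]) (mul_self_nonneg _))
  have hz := (Finset.sum_eq_zero_iff_of_nonpos hnp).1 horth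
  refine h.ne_zero hl (eq_zero_of_degree_lt_of_eval_finset_eq_zero s ?_ fun x hx => ?_)
  · rw [h.degree_eq hl]; exact_mod_cast hl.trans_le hN
  · have := hz x hx
    rw [mul_eq_zero, or_iff_right (hw x hx).ne', mul_eq_zero] at this
    refine this.elim id fun h1 => ?_
    rw [hg, eval_mul, h1, mul_zero]

theorem erase (h : IsOrthSystem s w p N) {y : ℝ} (hy : w y = 0) :
    IsOrthSystem (s.erase y) w p N := by
  refine ⟨h.1, h.2, fun l hl i hi => ?_⟩
  rw [← h.3 l hl i hi, discreteForm, discreteForm, Finset.sum_erase]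
  rw [hy, zero_mul]

end IsOrthSystem

/-! ### Reproducing kernels and the Christoffel transform -/

/-- The reproducing kernel `∑_{i ≤ l} p_i(y) p_i / ⟨p_i, p_i⟩`. -/
noncomputable def reproducingKernel (s : Finset ℝ) (w : ℝ → ℝ) (p : ℕ → ℝ[X]) (y : ℝ) (l : ℕ) :
    ℝ[X] :=
  ∑ i ∈ Finset.range (l + 1), C ((p i).eval y / discreteForm s w (p i) (p i)) * p i

namespace IsOrthSystem

variable {s : Finset ℝ} {w : ℝ → ℝ} {p : ℕ → ℝ[X]} {N : ℕ}

/-- Positivity is required of the norms only, not of the weights, since the kernel is later formed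
for the signed weight `(b - x) w(x)`. -/
theorem form_reproducingKernel (h : IsOrthSystem s w p N)
    (hpos : ∀ i < N, 0 < discreteForm s w (p i) (p i)) (y : ℝ) {l : ℕ} (hl : l < N) {f : ℝ[X]}
    (hf : f.degree < (l + 1 : ℕ)) :
    discreteForm s w (reproducingKernel s w p y l) f = f.eval y := by
  obtain ⟨c, rfl⟩ := exists_expansion h.1 h.2 (l + 1) hl f hf
  rw [reproducingKernel, discreteForm_sum_left, eval_finsetSum]
  refine Finset.sum_congr rfl fun i hi => ?_
  have hi := Finset.mem_range.1 hi
  rw [discreteForm_C_mul_left, h.form_sum hl hi, eval_mul, eval_C]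
  have := (hpos i (by omega)).ne'
  field_simp

theorem reproducingKernel_coeff (h : IsOrthSystem s w p N) (y : ℝ) {l : ℕ} (hl : l < N) :
    (reproducingKernel s w p y l).coeff l
      = (p l).eval y / discreteForm s w (p l) (p l) * (p l).leadingCoeff := by
  rw [reproducingKernel, finsetSum_coeff, Finset.sum_range_succ, Finset.sum_eq_zero]
  · rw [zero_add, coeff_C_mul, leadingCoeff, h.1 l hl]
  · intro i hi
    have hi := Finset.mem_range.1 hi
    rw [coeff_C_mul, coeff_eq_zero_of_natDegree_lt (by rw [h.1 i (by omega)]; exact hi), mul_zero]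

theorem reproducingKernel_natDegree (h : IsOrthSystem s w p N)
    (hpos : ∀ i < N, 0 < discreteForm s w (p i) (p i)) {y : ℝ} (hy : ∀ i < N, 0 < (p i).eval y)
    {l : ℕ} (hl : l < N) : (reproducingKernel s w p y l).natDegree = l := by
  refine natDegree_eq_of_le_of_coeff_ne_zero (natDegree_sum_le_of_forall_le _ _ fun i hi => ?_) ?_
  · have hi := Finset.mem_range.1 hi
    refine (natDegree_C_mul_le _ _).trans ?_
    rw [h.1 i (by omega)]; omega
  · rw [h.reproducingKernel_coeff y hl]
    exact (mul_pos (div_pos (hy l hl) (hpos l hl)) (h.2 l hl)).ne'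

/-- For `i < l` the polynomial `(y - X) K_i` has degree at most `l`, so `K_l` reproduces its value
at `y`, which is `0`. -/
theorem christoffel (h : IsOrthSystem s w p N)
    (hpos : ∀ i < N, 0 < discreteForm s w (p i) (p i)) {y : ℝ} (hy : ∀ i < N, 0 < (p i).eval y) :
    IsOrthSystem s (fun x => (y - x) * w x) (reproducingKernel s w p y) N := by
  refine ⟨fun l hl => h.reproducingKernel_natDegree hpos hy hl, fun l hl => ?_, fun l hl i hi => ?_⟩
  · rw [leadingCoeff, h.reproducingKernel_natDegree hpos hy hl, h.reproducingKernel_coeff y hl]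
    exact mul_pos (div_pos (hy l hl) (hpos l hl)) (h.2 l hl)
  · rw [discreteForm_sub_mul, h.form_reproducingKernel hpos y hl]
    · simp
    · have h1 : (C y - X : ℝ[X]).natDegree ≤ 1 := by compute_degree
      have h2 := h.reproducingKernel_natDegree hpos hy (hi.trans hl)
      refine degree_le_natDegree.trans_lt ?_
      have h3 : ((C y - X : ℝ[X]) * reproducingKernel s w p y i).natDegree ≤ 1 + i :=
        natDegree_mul_le_of_le h1 h2.le
      exact_mod_cast (by omega : _ < l + 1)

/-- The polynomial `(y - X) K_l + c p_{l+1}` has degree at most `l` for a suitable `c > 0`.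
Reproducing it at `y` gives the norm `c p_{l+1}(y)`, whatever the signs of the weights; the price is
the index `l + 1 < N`. -/
theorem christoffel_form_self_pos (h : IsOrthSystem s w p N)
    (hpos : ∀ i < N, 0 < discreteForm s w (p i) (p i)) {y : ℝ} (hy : ∀ i < N, 0 < (p i).eval y)
    {l : ℕ} (hl : l + 1 < N) :
    0 < discreteForm s (fun x => (y - x) * w x) (reproducingKernel s w p y l)
      (reproducingKernel s w p y l) := by
  set K := reproducingKernel s w p y l with hK
  have hKd : K.natDegree = l := h.reproducingKernel_natDegree hpos hy (by omega)
  have hKc : 0 < K.coeff l := by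
    rw [h.reproducingKernel_coeff y (by omega)]
    exact mul_pos (div_pos (hy l (by omega)) (hpos l (by omega))) (h.2 l (by omega))
  have hp := h.2 (l + 1) hl
  set c := K.coeff l / (p (l + 1)).leadingCoeff with hc
  have hcpos : 0 < c := div_pos hKc hp
  have hdeg : degree ((C y - X) * K + C c * p (l + 1)) < ((l + 1 : ℕ) : WithBot ℕ) := by
    rw [degree_lt_iff_coeff_zero]
    intro i hi
    obtain ⟨i, rfl⟩ : ∃ j, i = j + 1 := ⟨i - 1, by omega⟩
    have hKi : K.coeff (i + 1) = 0 := coeff_eq_zero_of_natDegree_lt (by omega)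
    rw [coeff_add, sub_mul, coeff_sub, coeff_C_mul, coeff_X_mul, coeff_C_mul, hKi]
    rcases (show l ≤ i by omega).eq_or_lt with rfl | hli
    · have : (p (l + 1)).coeff (l + 1) = (p (l + 1)).leadingCoeff := by rw [leadingCoeff, h.1 _ hl]
      rw [this, hc, div_mul_cancel₀ _ hp.ne']; ring
    · rw [coeff_eq_zero_of_natDegree_lt (show K.natDegree < i by omega),
        coeff_eq_zero_of_natDegree_lt (show (p (l + 1)).natDegree < i + 1 by rw [h.1 _ hl]; omega)]
      ring
  have hrep := h.form_reproducingKernel hpos y (show l < N by omega) hdeg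
  have horth : discreteForm s w K (p (l + 1)) = 0 := by
    rw [discreteForm_comm]
    refine h.orth_of_degree_lt hl ?_
    exact (degree_le_natDegree).trans_lt (by rw [hKd]; exact_mod_cast Nat.lt_succ_self l)
  rw [← hK, discreteForm_add_right, discreteForm_C_mul_right, horth] at hrep
  rw [discreteForm_sub_mul]
  have hev := hy (l + 1) hl
  simp only [eval_add, eval_mul, eval_sub, eval_C, eval_X, sub_self, zero_mul, zero_add, mul_zero,
    add_zero] at hrep
  rw [hrep]
  exact mul_pos hcpos hev

/-- Positive combinations of reproducing kernels are positive combinations of the `p_i`, with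
the coefficients given by the tails of the coefficient sequence. -/
theorem _root_.sum_reproducingKernel (s : Finset ℝ) (w : ℝ → ℝ) (p : ℕ → ℝ[X]) (y : ℝ)
    (e : ℕ → ℝ) (n : ℕ) :
    ∑ l ∈ Finset.range n, C (e l) * reproducingKernel s w p y l
      = ∑ i ∈ Finset.range n, C ((p i).eval y / discreteForm s w (p i) (p i)
          * ∑ l ∈ Finset.Ico i n, e l) * p i := by
  simp only [reproducingKernel, Finset.mul_sum, map_sum, Finset.sum_mul]
  rw [Finset.sum_sigma', Finset.sum_sigma']
  refine Finset.sum_bij' (fun x _ => ⟨x.2, x.1⟩) (fun x _ => ⟨x.2, x.1⟩) ?_ ?_ ?_ ?_ ?_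
  · intro x hx; simp at hx ⊢; omega
  · intro x hx; simp at hx ⊢; omega
  · intro x _; rfl
  · intro x _; rfl
  · intro x _; simp only [C_mul]; ring

/-! ### Positive expansions of products over the smallest nodes -/

/-- For positive weights, the monic polynomial vanishing at the smallest nodes is a positive
combination of the orthogonal polynomials. -/
theorem exists_pos_expansion : ∀ (n : ℕ) (s t : Finset ℝ) (w : ℝ → ℝ) (p : ℕ → ℝ[X]),
    s.card = n → (∀ x ∈ s, 0 < w x) → IsOrthSystem s w p n → t ⊆ s →
    (∀ x ∈ t, ∀ y ∈ s, y ∉ t → x < y) → t.card < n →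
    ∃ e : ℕ → ℝ, (∀ l ≤ t.card, 0 < e l) ∧
      ∏ x ∈ t, (X - C x) = ∑ l ∈ Finset.range (t.card + 1), C (e l) * p l := by
  intro n
  induction n with
  | zero => intro s t w p _ _ _ _ _ h; omega
  | succ n ih =>
    intro s t w p hs hw h hts hlow ht
    have hne : s.Nonempty := Finset.card_pos.1 (by omega)
    set y := s.max' hne with hy
    have hys : y ∈ s := s.max'_mem hne
    have hyle : ∀ x ∈ s, x ≤ y := fun x hx => s.le_max' x hx
    have hyt : y ∉ t := by
      obtain ⟨z, hzs, hzt⟩ := Finset.exists_mem_notMem_of_card_lt_card (hs ▸ ht)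
      intro hyt
      exact absurd (hlow y hyt z hzs hzt) (not_lt.2 (hyle z hzs))
    have hte : t ⊆ s.erase y := Finset.subset_erase.2 ⟨hts, hyt⟩
    have hce : (s.erase y).card = n := by rw [Finset.card_erase_of_mem hys, hs]; rfl
    have hpos : ∀ i < n + 1, 0 < discreteForm s w (p i) (p i) :=
      fun i hi => h.form_self_pos hw hs.ge hi
    have hev : ∀ i < n + 1, 0 < (p i).eval y := fun i hi => h.eval_pos hw hs.ge hyle hi
    rcases (Nat.le_of_lt_succ ht).eq_or_lt with htn | htn
    -- Only the node `y` lies outside `t`, so `⟨p_l, ∏ (X - x)⟩` reduces to one positive term.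
    · have hteq : t = s.erase y := Finset.eq_of_subset_of_card_le hte (by rw [hce, htn])
      obtain ⟨c, hc⟩ := exists_expansion h.1 h.2 (t.card + 1) ht (∏ x ∈ t, (X - C x)) (by
        rw [degree_prod]; simp
        exact_mod_cast Nat.lt_succ_self _)
      refine ⟨c, fun l hl => ?_, hc⟩
      have h1 := h.form_sum ht (Nat.lt_succ_of_le hl) c
      rw [← hc, discreteForm, ← Finset.add_sum_erase _ _ hys, Finset.sum_eq_zero, add_zero] at h1
      · have h2 : 0 < (∏ x ∈ t, (X - C x)).eval y := by
          rw [eval_prod]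
          refine Finset.prod_pos fun x hx => ?_
          simpa using hlow x hx y hys hyt
        have h3 := mul_pos (hw y hys) (mul_pos (hev l (by omega)) h2)
        rw [h1] at h3
        exact pos_of_mul_pos_left h3 (hpos l (by omega)).le
      · intro x hx
        rw [eval_prod, Finset.prod_eq_zero (hteq ▸ hx)] <;> simp
    -- The weight `(y - x) w(x)` vanishes at `y` and is positive at the other nodes. With one node
    -- fewer, one polynomial is dropped as well.
    · have h' := ((h.christoffel hpos hev).erase (y := y) (by simp)).mono n.le_succ
      obtain ⟨e, he, hprod⟩ := ih (s.erase y) t _ _ hce (fun x hx => mul_pos (sub_pos.2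
        (lt_of_le_of_ne (hyle x (Finset.mem_of_mem_erase hx)) (Finset.ne_of_mem_erase hx)))
        (hw x (Finset.mem_of_mem_erase hx))) h' hte
        (fun x hx z hz => hlow x hx z (Finset.mem_of_mem_erase hz)) htn
      rw [sum_reproducingKernel] at hprod
      refine ⟨_, fun l hl => ?_, hprod⟩
      refine mul_pos (div_pos (hev l (by omega)) (hpos l (by omega))) (Finset.sum_pos ?_ ?_)
      · intro i hi
        have := Finset.mem_Ico.1 hi
        exact he i (by omega)
      · exact ⟨l, Finset.mem_Ico.2 (by omega)⟩

end IsOrthSystem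

/-! ### Degrees and the Christoffel–Darboux formula -/

section jacobi

variable {α β γ ρ : ℕ → ℝ}

theorem jacobiPoly_natDegree_le_and_coeff_pos (hβ : ∀ l, 0 < β l) (hρ : ∀ l, 0 < ρ l) :
    ∀ l, (jacobiPoly α β γ ρ l).natDegree ≤ l ∧ 0 < (jacobiPoly α β γ ρ l).coeff l
  | 0 => by simp [jacobiPoly]
  | 1 => by
    have h := mul_pos (inv_pos.2 (hβ 0)) (hρ 0)
    rw [jacobiPoly]
    refine ⟨by compute_degree, ?_⟩
    simpa [coeff_X, coeff_C] using h
  | l + 2 => by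
    obtain ⟨h1, h2⟩ := jacobiPoly_natDegree_le_and_coeff_pos hβ hρ l
    obtain ⟨h3, h4⟩ := jacobiPoly_natDegree_le_and_coeff_pos hβ hρ (l + 1)
    have h5 : (C (ρ (l + 1)) * X - C (α (l + 1)) : ℝ[X]).natDegree ≤ 1 := by compute_degree
    rw [jacobiPoly]
    constructor
    · refine (natDegree_C_mul_le _ _).trans ((natDegree_sub_le_of_le
        (m := l + 2) (n := l + 2) ((natDegree_mul_le_of_le h5 h3).trans (by omega)) ?_).trans
        (max_self _).le)
      exact (natDegree_C_mul_le _ _).trans (by omega)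
    · rw [coeff_C_mul, coeff_sub, coeff_C_mul, sub_mul, coeff_sub, mul_assoc, coeff_C_mul,
        coeff_X_mul, coeff_C_mul,
        coeff_eq_zero_of_natDegree_lt (show natDegree (jacobiPoly α β γ ρ (l + 1)) < l + 2 by omega),
        coeff_eq_zero_of_natDegree_lt (show natDegree (jacobiPoly α β γ ρ l) < l + 2 by omega)]
      simpa using mul_pos (inv_pos.2 (hβ (l + 1))) (mul_pos (hρ (l + 1)) h4)

theorem jacobiPoly_natDegree (hβ : ∀ l, 0 < β l) (hρ : ∀ l, 0 < ρ l) (l : ℕ) :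
    (jacobiPoly α β γ ρ l).natDegree = l :=
  have h := jacobiPoly_natDegree_le_and_coeff_pos (α := α) (γ := γ) hβ hρ l
  natDegree_eq_of_le_of_coeff_ne_zero h.1 h.2.ne'

theorem jacobiPoly_leadingCoeff_pos (hβ : ∀ l, 0 < β l) (hρ : ∀ l, 0 < ρ l) (l : ℕ) :
    0 < (jacobiPoly α β γ ρ l).leadingCoeff := by
  rw [leadingCoeff, jacobiPoly_natDegree hβ hρ]
  exact (jacobiPoly_natDegree_le_and_coeff_pos hβ hρ l).2

theorem jacobiPoly_ne_zero (hβ : ∀ l, 0 < β l) (hρ : ∀ l, 0 < ρ l) (l : ℕ) :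
    jacobiPoly α β γ ρ l ≠ 0 :=
  leadingCoeff_ne_zero.1 (jacobiPoly_leadingCoeff_pos hβ hρ l).ne'

theorem jacobiNorm_pos (hβ : ∀ l, 0 < β l) (hγ : ∀ l, 0 < γ l) (hρ : ∀ l, 0 < ρ l) (l : ℕ) :
    0 < jacobiNorm β γ ρ l :=
  mul_pos (hρ l) (div_pos (Finset.prod_pos fun i _ => hβ i) (Finset.prod_pos fun i _ => hγ i))

/-- The constant `(β_0 ⋯ β_n) / (γ_0 ⋯ γ_{n-1})` of the Christoffel–Darboux formula. -/
noncomputable def darbouxConst (β γ : ℕ → ℝ) (n : ℕ) : ℝ :=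
  (∏ i ∈ Finset.range (n + 1), β i) / ∏ i ∈ Finset.range n, γ i

theorem darbouxConst_pos (hβ : ∀ l, 0 < β l) (hγ : ∀ l, 0 < γ l) (n : ℕ) :
    0 < darbouxConst β γ n :=
  div_pos (Finset.prod_pos fun i _ => hβ i) (Finset.prod_pos fun i _ => hγ i)

/-- The Christoffel–Darboux formula. -/
theorem jacobiPoly_christoffel_darboux {A : Type*} [CommRing A] [Algebra ℝ A]
    (hβ : ∀ l, 0 < β l) (hγ : ∀ l, 0 < γ l) (x y : A) (n : ℕ) :
    (x - y) * ∑ l ∈ Finset.range (n + 1), algebraMap ℝ A (jacobiNorm β γ ρ l) *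
        (aeval x (jacobiPoly α β γ ρ l) * aeval y (jacobiPoly α β γ ρ l))
      = algebraMap ℝ A (darbouxConst β γ n) *
        (aeval x (jacobiPoly α β γ ρ (n + 1)) * aeval y (jacobiPoly α β γ ρ n)
          - aeval x (jacobiPoly α β γ ρ n) * aeval y (jacobiPoly α β γ ρ (n + 1))) := by
  induction n with
  | zero =>
    have hx := congrArg (aeval x) (jacobiPoly_rec_zero α β γ ρ hβ)
    have hy := congrArg (aeval y) (jacobiPoly_rec_zero α β γ ρ hβ)
    have h0 : jacobiPoly α β γ ρ 0 = 1 := rfl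
    simp only [map_add, map_mul, aeval_C, aeval_X, h0, map_one] at hx hy
    simp [jacobiNorm, darbouxConst, h0]
    linear_combination hy - hx
  | succ n ih =>
    have hx := congrArg (aeval x) (jacobiPoly_rec_succ α β γ ρ hβ n)
    have hy := congrArg (aeval y) (jacobiPoly_rec_succ α β γ ρ hβ n)
    simp only [map_add, map_mul, aeval_C, aeval_X] at hx hy
    have h1 : jacobiNorm β γ ρ (n + 1) = ρ (n + 1) * (darbouxConst β γ n / γ n) := by
      rw [jacobiNorm, darbouxConst, Finset.prod_range_succ γ, div_div]
    have h2 : darbouxConst β γ (n + 1) = darbouxConst β γ n / γ n * β (n + 1) := by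
      rw [darbouxConst, darbouxConst, Finset.prod_range_succ γ, Finset.prod_range_succ β (n + 1),
        div_div]
      ring
    have h3 : darbouxConst β γ n = darbouxConst β γ n / γ n * γ n :=
      (div_mul_cancel₀ _ (hγ n).ne').symm
    rw [Finset.sum_range_succ, mul_add, ih, h1, h2]
    generalize darbouxConst β γ n / γ n = u at *
    rw [h3]
    simp only [map_mul]
    linear_combination algebraMap ℝ A u * (aeval x (jacobiPoly α β γ ρ (n + 1)) * hy
      - aeval y (jacobiPoly α β γ ρ (n + 1)) * hx)

theorem jacobiPoly_christoffel_darboux_real (hβ : ∀ l, 0 < β l) (hγ : ∀ l, 0 < γ l) (x y : ℝ)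
    (n : ℕ) :
    (x - y) * ∑ l ∈ Finset.range (n + 1), jacobiNorm β γ ρ l *
        ((jacobiPoly α β γ ρ l).eval x * (jacobiPoly α β γ ρ l).eval y)
      = darbouxConst β γ n *
        ((jacobiPoly α β γ ρ (n + 1)).eval x * (jacobiPoly α β γ ρ n).eval y
          - (jacobiPoly α β γ ρ n).eval x * (jacobiPoly α β γ ρ (n + 1)).eval y) := by
  simpa [coe_aeval_eq_eval] using
    jacobiPoly_christoffel_darboux (α := α) (ρ := ρ) hβ hγ x y n

theorem jacobiPoly_christoffel_darboux_X (hβ : ∀ l, 0 < β l) (hγ : ∀ l, 0 < γ l) (y : ℝ)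
    (n : ℕ) :
    (X - C y) * ∑ l ∈ Finset.range (n + 1),
        C (jacobiNorm β γ ρ l * (jacobiPoly α β γ ρ l).eval y) * jacobiPoly α β γ ρ l
      = C (darbouxConst β γ n) *
        (C ((jacobiPoly α β γ ρ n).eval y) * jacobiPoly α β γ ρ (n + 1)
          - C ((jacobiPoly α β γ ρ (n + 1)).eval y) * jacobiPoly α β γ ρ n) := by
  refine Polynomial.funext fun x => ?_
  have h := jacobiPoly_christoffel_darboux_real (α := α) (ρ := ρ) hβ hγ x y n
  simp only [eval_mul, eval_sub, eval_X, eval_C, eval_finsetSum]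
  rw [show ∀ a b c d : ℝ, a * b - c * d = b * a - d * c from fun _ _ _ _ => by ring, ← h]
  congr 1
  exact Finset.sum_congr rfl fun l _ => by ring

/-! ### Real and simple zeros -/

theorem jacobiPoly_kernel_self_pos (hβ : ∀ l, 0 < β l) (hγ : ∀ l, 0 < γ l) (hρ : ∀ l, 0 < ρ l)
    (x : ℝ) (n : ℕ) :
    0 < ∑ l ∈ Finset.range (n + 1), jacobiNorm β γ ρ l *
        ((jacobiPoly α β γ ρ l).eval x * (jacobiPoly α β γ ρ l).eval x) := by
  refine Finset.sum_pos' (fun l _ => mul_nonneg (jacobiNorm_pos hβ hγ hρ l).le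
    (mul_self_nonneg _)) ⟨0, by simp, ?_⟩
  simpa [jacobiPoly] using jacobiNorm_pos hβ hγ hρ 0

/-- At a complex zero `z` of `P_{n+1}`, Christoffel–Darboux for `z` and its conjugate reads `(z -
z̄) ∑ d_l |P_l(z)|² = 0`, with a positive sum. -/
theorem jacobiPoly_splits (hβ : ∀ l, 0 < β l) (hγ : ∀ l, 0 < γ l) (hρ : ∀ l, 0 < ρ l) (n : ℕ) :
    (jacobiPoly α β γ ρ (n + 1)).Splits := by
  refine Splits.of_splits_map (algebraMap ℝ ℂ) (IsAlgClosed.splits _) fun z hz => ?_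
  have hz0 : aeval z (jacobiPoly α β γ ρ (n + 1)) = 0 := by
    rw [aeval_def, ← eval_map]
    exact isRoot_of_mem_roots hz
  have hconj : ∀ p : ℝ[X], aeval (starRingEnd ℂ z) p = starRingEnd ℂ (aeval z p) := fun p =>
    aeval_conj p z
  have h := jacobiPoly_christoffel_darboux (α := α) (ρ := ρ) hβ hγ z (starRingEnd ℂ z) n
  simp only [hconj, hz0, map_zero, mul_zero, zero_mul, sub_zero, Complex.mul_conj,
    Complex.coe_algebraMap] at h
  rcases mul_eq_zero.1 h with h | h
  · rw [sub_eq_zero, eq_comm, Complex.conj_eq_iff_real] at h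
    obtain ⟨r, hr⟩ := h
    exact ⟨r, hr.symm⟩
  · exfalso
    have h : (∑ l ∈ Finset.range (n + 1), jacobiNorm β γ ρ l *
        Complex.normSq (aeval z (jacobiPoly α β γ ρ l))) = 0 := by exact_mod_cast h
    refine (Finset.sum_pos' (fun l _ => mul_nonneg (jacobiNorm_pos hβ hγ hρ l).le
      (Complex.normSq_nonneg _)) ⟨0, by simp, ?_⟩).ne' h
    simpa [jacobiPoly] using jacobiNorm_pos hβ hγ hρ 0

/-- Differentiating Christoffel–Darboux at a multiple zero `x` would give `∑ d_l P_l(x)² = 0`. -/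
theorem jacobiPoly_roots_nodup (hβ : ∀ l, 0 < β l) (hγ : ∀ l, 0 < γ l) (hρ : ∀ l, 0 < ρ l)
    (n : ℕ) : (jacobiPoly α β γ ρ (n + 1)).roots.Nodup := by
  rw [Multiset.nodup_iff_count_le_one]
  intro x
  rw [count_roots]
  by_contra! hx
  rw [one_lt_rootMultiplicity_iff_isRoot (jacobiPoly_ne_zero hβ hρ _)] at hx
  have h := congrArg (fun p => (derivative p).eval x)
    (jacobiPoly_christoffel_darboux_X (α := α) (ρ := ρ) hβ hγ x n)
  obtain ⟨h1, h2⟩ := hx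
  rw [IsRoot] at h1 h2
  simp only [h1, derivative_mul, derivative_sub, derivative_X, derivative_C, eval_add, eval_mul,
    eval_sub, eval_X, eval_C, h2, map_zero, zero_mul, mul_zero, sub_self, add_zero, sub_zero,
    one_mul, zero_add, eval_finsetSum] at h
  refine (jacobiPoly_kernel_self_pos (α := α) hβ hγ hρ x n).ne' ?_
  rw [← h]
  exact Finset.sum_congr rfl fun l _ => by ring

theorem jacobiPoly_card_roots (hβ : ∀ l, 0 < β l) (hγ : ∀ l, 0 < γ l) (hρ : ∀ l, 0 < ρ l)
    (n : ℕ) : (jacobiPoly α β γ ρ (n + 1)).roots.toFinset.card = n + 1 := by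
  rw [Multiset.toFinset_card_of_nodup (jacobiPoly_roots_nodup hβ hγ hρ n),
    ← (jacobiPoly_splits hβ hγ hρ n).natDegree_eq_card_roots, jacobiPoly_natDegree hβ hρ]

theorem jacobiPoly_eq_prod_roots (hβ : ∀ l, 0 < β l) (hγ : ∀ l, 0 < γ l) (hρ : ∀ l, 0 < ρ l)
    (n : ℕ) : jacobiPoly α β γ ρ (n + 1) = C (jacobiPoly α β γ ρ (n + 1)).leadingCoeff *
      ∏ x ∈ (jacobiPoly α β γ ρ (n + 1)).roots.toFinset, (X - C x) := by
  conv_lhs => rw [(jacobiPoly_splits hβ hγ hρ n).eq_prod_roots]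
  rw [Finset.prod_multiset_map_count]
  congr 1
  refine Finset.prod_congr rfl fun x hx => ?_
  rw [Multiset.count_eq_one_of_mem (jacobiPoly_roots_nodup hβ hγ hρ n)
    (Multiset.mem_toFinset.1 hx), pow_one]

/-! ### Gauss quadrature and positivity to the right of the zeros -/

/-- The weights of the Gauss quadrature with nodes the zeros of `P_{n+1}`. -/
noncomputable def gaussWeight (α β γ ρ : ℕ → ℝ) (n : ℕ) (x : ℝ) : ℝ :=
  (∑ l ∈ Finset.range (n + 1), jacobiNorm β γ ρ l *
        ((jacobiPoly α β γ ρ l).eval x * (jacobiPoly α β γ ρ l).eval x))⁻¹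

theorem gaussWeight_pos (hβ : ∀ l, 0 < β l) (hγ : ∀ l, 0 < γ l) (hρ : ∀ l, 0 < ρ l)
    (n : ℕ) (x : ℝ) : 0 < gaussWeight α β γ ρ n x :=
  inv_pos.2 (jacobiPoly_kernel_self_pos hβ hγ hρ x n)

/-- Discrete orthogonality of `P_0, …, P_n` at the zeros of `P_{n+1}`. -/
theorem jacobiPoly_form (hβ : ∀ l, 0 < β l) (hγ : ∀ l, 0 < γ l) (hρ : ∀ l, 0 < ρ l)
    (n : ℕ) {l k : ℕ} (hl : l < n + 1) (hk : k < n + 1) :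
    discreteForm (jacobiPoly α β γ ρ (n + 1)).roots.toFinset (gaussWeight α β γ ρ n)
      (jacobiPoly α β γ ρ l) (jacobiPoly α β γ ρ k)
      = if l = k then (jacobiNorm β γ ρ l)⁻¹ else 0 := by
  set s := (jacobiPoly α β γ ρ (n + 1)).roots.toFinset with hs
  have hcard : Fintype.card s = Fintype.card (Fin (n + 1)) := by
    rw [Fintype.card_coe, jacobiPoly_card_roots hβ hγ hρ, Fintype.card_fin]
  let e : s ≃ Fin (n + 1) := Fintype.equivOfCardEq hcard
  let M : Matrix (Fin (n + 1)) (Fin (n + 1)) ℝ :=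
    fun i j => gaussWeight α β γ ρ n (e.symm i) * (jacobiPoly α β γ ρ j).eval (e.symm i : ℝ)
  let M' : Matrix (Fin (n + 1)) (Fin (n + 1)) ℝ :=
    fun j i => jacobiNorm β γ ρ j * (jacobiPoly α β γ ρ j).eval (e.symm i : ℝ)
  have hroot : ∀ x : s, (jacobiPoly α β γ ρ (n + 1)).eval (x : ℝ) = 0 := fun x =>
    isRoot_of_mem_roots (Multiset.mem_toFinset.1 x.2)
  -- Christoffel–Darboux gives orthogonality over the degree for two zeros; since the matrices are
  -- square, the reversed product gives orthogonality over the nodes.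
  have hMM : M * M' = 1 := by
    ext i j
    have hsum : (M * M') i j = gaussWeight α β γ ρ n (e.symm i) *
        ∑ l ∈ Finset.range (n + 1), jacobiNorm β γ ρ l *
        ((jacobiPoly α β γ ρ l).eval (e.symm i : ℝ) *
          (jacobiPoly α β γ ρ l).eval (e.symm j : ℝ)) := by
      rw [Matrix.mul_apply, Finset.mul_sum, Finset.sum_range]
      exact Finset.sum_congr rfl fun l _ => by simp only [M, M']; ring
    rw [hsum, Matrix.one_apply]
    split_ifs with hij
    · subst hij
      exact inv_mul_cancel₀ (jacobiPoly_kernel_self_pos hβ hγ hρ _ n).ne'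
    · have h := jacobiPoly_christoffel_darboux_real (α := α) (ρ := ρ) hβ hγ (e.symm i : ℝ)
        (e.symm j : ℝ) n
      rw [hroot, hroot, zero_mul, mul_zero, sub_zero, mul_zero] at h
      rw [(mul_eq_zero.1 h).resolve_left, mul_zero]
      exact fun h' => hij (e.symm.injective (Subtype.ext (sub_eq_zero.1 h')))
  have hMM' : M' * M = 1 := mul_eq_one_comm.1 hMM
  have h := congrFun (congrFun hMM' ⟨l, hl⟩) ⟨k, hk⟩
  have hsum : (M' * M) ⟨l, hl⟩ ⟨k, hk⟩ = jacobiNorm β γ ρ l *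
      discreteForm s (gaussWeight α β γ ρ n) (jacobiPoly α β γ ρ l) (jacobiPoly α β γ ρ k) := by
    rw [Matrix.mul_apply, discreteForm, Finset.mul_sum, ← Finset.sum_coe_sort s, ← e.symm.sum_comp]
    exact Finset.sum_congr rfl fun l _ => by simp only [M, M']; ring
  rw [hsum, Matrix.one_apply] at h
  have hd := (jacobiNorm_pos hβ hγ hρ l).ne'
  simp only [Fin.mk.injEq] at h
  split_ifs at h ⊢
  · exact eq_inv_of_mul_eq_one_right h
  · exact (mul_eq_zero.1 h).resolve_left hd

theorem jacobiPoly_isOrthSystem (hβ : ∀ l, 0 < β l) (hγ : ∀ l, 0 < γ l) (hρ : ∀ l, 0 < ρ l)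
    (n : ℕ) : IsOrthSystem (jacobiPoly α β γ ρ (n + 1)).roots.toFinset (gaussWeight α β γ ρ n)
      (jacobiPoly α β γ ρ) (n + 1) :=
  ⟨fun l _ => jacobiPoly_natDegree hβ hρ l, fun l _ => jacobiPoly_leadingCoeff_pos hβ hρ l,
    fun l hl i hi => by rw [jacobiPoly_form hβ hγ hρ n hl (hi.trans hl), if_neg hi.ne']⟩

theorem jacobiPoly_eval_pos (hβ : ∀ l, 0 < β l) (hγ : ∀ l, 0 < γ l) (hρ : ∀ l, 0 < ρ l)
    {n : ℕ} {y : ℝ} (hy : ∀ x, (jacobiPoly α β γ ρ (n + 1)).IsRoot x → x ≤ y)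
    {l : ℕ} (hl : l < n + 1) : 0 < (jacobiPoly α β γ ρ l).eval y :=
  (jacobiPoly_isOrthSystem hβ hγ hρ n).eval_pos (fun x _ => gaussWeight_pos hβ hγ hρ n x)
    (jacobiPoly_card_roots hβ hγ hρ n).ge
    (fun x hx => hy x (isRoot_of_mem_roots (Multiset.mem_toFinset.1 hx))) hl

theorem jacobiPoly_eval_pos_of_lt (hβ : ∀ l, 0 < β l) (hγ : ∀ l, 0 < γ l) (hρ : ∀ l, 0 < ρ l)
    {n : ℕ} (hn : 1 ≤ n) {y : ℝ} (hy : ∀ x, (jacobiPoly α β γ ρ n).IsRoot x → x < y)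
    {l : ℕ} (hl : l ≤ n) : 0 < (jacobiPoly α β γ ρ l).eval y := by
  obtain ⟨n, rfl⟩ : ∃ k, n = k + 1 := ⟨n - 1, by omega⟩
  rcases hl.eq_or_lt with rfl | hl
  · exact zero_lt_eval_of_roots_lt_of_leadingCoeff_nonneg hy
      (jacobiPoly_leadingCoeff_pos hβ hρ _).le
  · exact jacobiPoly_eval_pos hβ hγ hρ (fun x hx => (hy x hx).le) hl

end jacobi

/-! ### Expansion of the quotient for an unperturbed `P_{q+1}` -/

section zeros

variable {α β γ ρ : ℕ → ℝ}

theorem jacobiPoly_expansion_unique (hβ : ∀ l, 0 < β l) (hγ : ∀ l, 0 < γ l) (hρ : ∀ l, 0 < ρ l)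
    {a a' : ℕ → ℝ} {k : ℕ}
    (h : ∑ l ∈ Finset.range k, C (a l) * jacobiPoly α β γ ρ l
      = ∑ l ∈ Finset.range k, C (a' l) * jacobiPoly α β γ ρ l) {l : ℕ} (hl : l < k) :
    a l = a' l := by
  have hP := jacobiPoly_isOrthSystem (α := α) hβ hγ hρ k
  have h1 := hP.form_sum k.le_succ hl a
  rw [h, hP.form_sum k.le_succ hl a'] at h1
  refine (mul_right_cancel₀ ?_ h1).symm
  rw [jacobiPoly_form hβ hγ hρ k (by omega) (by omega), if_pos rfl]
  exact inv_ne_zero (jacobiNorm_pos hβ hγ hρ l).ne'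

/-- Only the largest zero of `P_{q+1}` can exceed all the zeros of `P_q`. -/
theorem lt_of_isRoot_of_lt (hβ : ∀ l, 0 < β l) (hγ : ∀ l, 0 < γ l) (hρ : ∀ l, 0 < ρ l)
    {q : ℕ} (hq : 1 ≤ q) {b x y : ℝ} (hb : ∀ r, (jacobiPoly α β γ ρ q).IsRoot r → r < b)
    (hx : (jacobiPoly α β γ ρ (q + 1)).IsRoot x) (hy : (jacobiPoly α β γ ρ (q + 1)).IsRoot y)
    (hxy : x < y) : x < b := by
  -- Otherwise every `P_l` with `l ≤ q` is positive at both zeros, and the vanishing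
  -- Christoffel–Darboux sum has only positive terms.
  by_contra! hbx
  have h := jacobiPoly_christoffel_darboux_real (α := α) (ρ := ρ) hβ hγ y x q
  rw [hx.eq_zero, hy.eq_zero, zero_mul, mul_zero, sub_zero, mul_zero] at h
  refine (mul_pos (sub_pos.2 hxy) (Finset.sum_pos (fun l hl => ?_) ⟨0, by simp⟩)).ne' h
  have hl := Finset.mem_range_succ_iff.1 hl
  exact mul_pos (jacobiNorm_pos hβ hγ hρ l) (mul_pos
    (jacobiPoly_eval_pos_of_lt hβ hγ hρ hq (fun r hr => (hb r hr).trans (hbx.trans_lt hxy)) hl)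
    (jacobiPoly_eval_pos_of_lt hβ hγ hρ hq (fun r hr => (hb r hr).trans_le hbx) hl))

/-- The monic polynomial vanishing at the smallest zeros of `P_{q+1}`, at least one zero besides
the largest one being left out, is a positive combination of the kernel polynomials at `b`. -/
theorem exists_pos_kernel_expansion (hβ : ∀ l, 0 < β l) (hγ : ∀ l, 0 < γ l) (hρ : ∀ l, 0 < ρ l)
    {q : ℕ} (hq : 1 ≤ q) {b y : ℝ} (hb : ∀ r, (jacobiPoly α β γ ρ q).IsRoot r → r < b)
    {s t : Finset ℝ} (hs : s = (jacobiPoly α β γ ρ (q + 1)).roots.toFinset)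
    (hy : y ∈ s) (hmax : ∀ x ∈ s, x ≤ y) (ht : t ⊆ s.erase y)
    (hlow : ∀ x ∈ t, ∀ z ∈ s.erase y, z ∉ t → x < z) (htq : t.card < q) :
    ∃ E : ℕ → ℝ, (∀ l ≤ t.card, 0 < E l) ∧
      ∏ x ∈ t, (X - C x) = ∑ l ∈ Finset.range (t.card + 1),
        C (E l) * reproducingKernel s (gaussWeight α β γ ρ q) (jacobiPoly α β γ ρ) b l := by
  have hroot : ∀ x ∈ s, (jacobiPoly α β γ ρ (q + 1)).IsRoot x := fun x hx => by
    rw [hs] at hx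
    exact isRoot_of_mem_roots (Multiset.mem_toFinset.1 hx)
  have hmem : ∀ x, (jacobiPoly α β γ ρ (q + 1)).IsRoot x → x ∈ s := fun x hx => by
    rw [hs, Multiset.mem_toFinset]
    exact (mem_roots (jacobiPoly_ne_zero hβ hρ _)).2 hx
  have hP := jacobiPoly_isOrthSystem (α := α) hβ hγ hρ q
  have hcard := jacobiPoly_card_roots (α := α) hβ hγ hρ q
  rw [← hs] at hP hcard
  set w := gaussWeight α β γ ρ q with hw
  have hwpos : ∀ x, 0 < w x := gaussWeight_pos hβ hγ hρ q
  have hPpos : ∀ i < q + 1, 0 < discreteForm s w (jacobiPoly α β γ ρ i) (jacobiPoly α β γ ρ i) :=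
    fun i hi => hP.form_self_pos (fun x _ => hwpos x) hcard.ge hi
  have hPb : ∀ i < q + 1, 0 < (jacobiPoly α β γ ρ i).eval b := fun i hi =>
    jacobiPoly_eval_pos_of_lt hβ hγ hρ hq hb (Nat.le_of_lt_succ hi)
  have hPy : ∀ i < q + 1, 0 < (jacobiPoly α β γ ρ i).eval y := fun i hi =>
    jacobiPoly_eval_pos hβ hγ hρ (fun x hx => hmax x (hmem x hx)) hi
  -- The index `q` is dropped: the norm of `K_q` for `(b - x) w(x)` need not be positive.
  have hK := (hP.christoffel hPpos hPb).mono q.le_succ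
  have hKpos := fun i (hi : i < q) => hP.christoffel_form_self_pos hPpos hPb (Nat.succ_lt_succ hi)
  have hKy : ∀ i < q, 0 < (reproducingKernel s w (jacobiPoly α β γ ρ) b i).eval y := by
    intro i hi
    rw [reproducingKernel, eval_finsetSum]
    refine Finset.sum_pos (fun j hj => ?_) ⟨0, by simp⟩
    have hj := Finset.mem_range.1 hj
    rw [eval_mul, eval_C]
    exact mul_pos (div_pos (hPb j (by omega)) (hPpos j (by omega))) (hPy j (by omega))
  -- The factor `y - x` kills the one node at which `b - x` may fail to be positive.
  have hQ := (hK.christoffel hKpos hKy).erase (y := y) (by simp)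
  have hce : (s.erase y).card = q := by rw [Finset.card_erase_of_mem hy, hcard]; rfl
  obtain ⟨e, he, hprod⟩ := IsOrthSystem.exists_pos_expansion q (s.erase y) t _ _ hce
    (fun x hx => by
      have hxs := Finset.mem_of_mem_erase hx
      have hxy := lt_of_le_of_ne (hmax x hxs) (Finset.ne_of_mem_erase hx)
      exact mul_pos (sub_pos.2 hxy) (mul_pos (sub_pos.2
        (lt_of_isRoot_of_lt hβ hγ hρ hq hb (hroot x hxs) (hroot y hy) hxy)) (hwpos x)))
    hQ ht hlow htq
  rw [sum_reproducingKernel] at hprod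
  refine ⟨_, fun l hl => ?_, hprod⟩
  refine mul_pos (div_pos (hKy l (by omega)) (hKpos l (by omega))) (Finset.sum_pos ?_ ?_)
  · intro i hi
    have := Finset.mem_Ico.1 hi
    exact he i (by omega)
  · exact ⟨l, Finset.mem_Ico.2 (by omega)⟩

theorem exists_isDecreasingZeros (hβ : ∀ l, 0 < β l) (hγ : ∀ l, 0 < γ l) (hρ : ∀ l, 0 < ρ l)
    (q : ℕ) : ∃ z : ℕ → ℝ, IsDecreasingZeros (jacobiPoly α β γ ρ (q + 1)) (q + 1) z := by
  set s := (jacobiPoly α β γ ρ (q + 1)).roots.toFinset with hs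
  have hc : s.card = q + 1 := jacobiPoly_card_roots hβ hγ hρ q
  -- The increasing enumeration is reversed and shifted to start at `1`. Truncated subtraction keeps
  -- the index valid for every `j`.
  refine ⟨fun j => s.orderEmbOfFin hc ⟨q - (j - 1), by omega⟩, fun i hi j hj hij => ?_, ?_⟩
  · simp only [OrderEmbedding.lt_iff_lt, Fin.mk_lt_mk]
    simp only [Set.mem_Icc] at hi hj
    omega
  · have hset : {x : ℝ | (jacobiPoly α β γ ρ (q + 1)).IsRoot x} = s := by
      ext x
      simp [hs, jacobiPoly_ne_zero hβ hρ]
    rw [hset, ← Finset.range_orderEmbOfFin s hc]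
    ext x
    constructor
    · rintro ⟨i, rfl⟩
      refine ⟨q + 1 - i, ⟨by omega, by omega⟩, ?_⟩
      simp only
      congr 2
      omega
    · rintro ⟨j, _, rfl⟩
      exact ⟨_, rfl⟩

variable {q m : ℕ} {z : ℕ → ℝ}

theorem IsDecreasingZeros.roots_toFinset (hβ : ∀ l, 0 < β l) (hρ : ∀ l, 0 < ρ l) {n : ℕ}
    (hz : IsDecreasingZeros (jacobiPoly α β γ ρ n) n z) :
    (jacobiPoly α β γ ρ n).roots.toFinset = (Finset.Icc 1 n).image z := by
  ext x
  have h : x ∈ {x : ℝ | (jacobiPoly α β γ ρ n).IsRoot x} ↔ x ∈ z '' Set.Icc 1 n := by rw [hz.2]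
  simpa [jacobiPoly_ne_zero hβ hρ] using h

theorem IsDecreasingZeros.eq_mul (hβ : ∀ l, 0 < β l) (hγ : ∀ l, 0 < γ l) (hρ : ∀ l, 0 < ρ l)
    (hm : m ≤ q) (hz : IsDecreasingZeros (jacobiPoly α β γ ρ (q + 1)) (q + 1) z) :
    jacobiPoly α β γ ρ (q + 1) = (∏ j ∈ Finset.Icc 1 (m + 1), (X - C (z j))) *
      (C (jacobiPoly α β γ ρ (q + 1)).leadingCoeff *
        ∏ j ∈ Finset.Icc (m + 2) (q + 1), (X - C (z j))) := by
  have hinj : Set.InjOn z (Finset.Icc 1 (q + 1)) := by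
    rw [Finset.coe_Icc]; exact hz.1.injOn
  conv_lhs => rw [jacobiPoly_eq_prod_roots hβ hγ hρ q, hz.roots_toFinset hβ hρ,
    Finset.prod_image hinj]
  have hu : Finset.Icc 1 (q + 1) = Finset.Icc 1 (m + 1) ∪ Finset.Icc (m + 2) (q + 1) := by
    ext j; simp only [Finset.mem_union, Finset.mem_Icc]; omega
  rw [hu, Finset.prod_union]
  · ring
  · rw [Finset.disjoint_left]
    intro j; simp only [Finset.mem_Icc]; omega

theorem exists_quotient_expansion (hβ : ∀ l, 0 < β l) (hγ : ∀ l, 0 < γ l) (hρ : ∀ l, 0 < ρ l)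
    (hm : m ≤ q) (hz : IsDecreasingZeros (jacobiPoly α β γ ρ (q + 1)) (q + 1) z) :
    ∃ c : ℕ → ℝ, jacobiPoly α β γ ρ (q + 1) = (∏ j ∈ Finset.Icc 1 (m + 1), (X - C (z j))) *
      ∑ l ∈ Finset.range (q - m + 1), C (jacobiNorm β γ ρ l * c l) * jacobiPoly α β γ ρ l := by
  obtain ⟨c, hc⟩ := exists_expansion (p := jacobiPoly α β γ ρ)
    (fun l _ => jacobiPoly_natDegree hβ hρ l) (fun l _ => jacobiPoly_leadingCoeff_pos hβ hρ l)
    (q - m + 1) le_rfl (C (jacobiPoly α β γ ρ (q + 1)).leadingCoeff *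
        ∏ j ∈ Finset.Icc (m + 2) (q + 1), (X - C (z j))) (by
      rw [degree_C_mul (jacobiPoly_leadingCoeff_pos hβ hρ _).ne', degree_prod]
      simp only [degree_X_sub_C, Finset.sum_const, Nat.card_Icc, nsmul_eq_mul, mul_one]
      exact_mod_cast (by omega : q + 1 + 1 - (m + 2) < q - m + 1))
  refine ⟨fun l => c l / jacobiNorm β γ ρ l, ?_⟩
  conv_lhs => rw [hz.eq_mul hβ hγ hρ hm, hc]
  congr 1
  refine Finset.sum_congr rfl fun l _ => ?_
  rw [mul_div_cancel₀ _ (jacobiNorm_pos hβ hγ hρ l).ne']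

/-- The ratios are tail sums of the positive kernel coefficients `E_i`. The condition `m ≥ 1` makes
the quotient retain at most `q - 1` zeros, as the kernel expansion needs. -/
theorem quotient_coeff_strictAnti (hβ : ∀ l, 0 < β l) (hγ : ∀ l, 0 < γ l) (hρ : ∀ l, 0 < ρ l)
    (hm1 : 1 ≤ m) (hm : m ≤ q) {b : ℝ} (hb : ∀ r, (jacobiPoly α β γ ρ q).IsRoot r → r < b)
    (hz : IsDecreasingZeros (jacobiPoly α β γ ρ (q + 1)) (q + 1) z) {c : ℕ → ℝ}
    (hc : jacobiPoly α β γ ρ (q + 1) = (∏ j ∈ Finset.Icc 1 (m + 1), (X - C (z j))) *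
      ∑ l ∈ Finset.range (q - m + 1), C (jacobiNorm β γ ρ l * c l) * jacobiPoly α β γ ρ l) :
    (∀ l < q - m, c l / (jacobiPoly α β γ ρ l).eval b >
        c (l + 1) / (jacobiPoly α β γ ρ (l + 1)).eval b) ∧
      c (q - m) / (jacobiPoly α β γ ρ (q - m)).eval b > 0 := by
  have hinj : Set.InjOn z (Finset.Icc 1 (q + 1)) := by
    rw [Finset.coe_Icc]; exact hz.1.injOn
  have hsub : Finset.Icc (m + 2) (q + 1) ⊆ Finset.Icc 1 (q + 1) :=
    Finset.Icc_subset_Icc_left (by omega)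
  have hinj' : Set.InjOn z (Finset.Icc (m + 2) (q + 1)) := hinj.mono (by exact_mod_cast hsub)
  have h1mem : 1 ∈ Set.Icc 1 (q + 1) := ⟨le_rfl, by omega⟩
  set t := (Finset.Icc (m + 2) (q + 1)).image z with ht
  have htc : t.card = q - m := by
    rw [ht, Finset.card_image_of_injOn hinj', Nat.card_Icc]; omega
  obtain ⟨E, hE, hprod⟩ := exists_pos_kernel_expansion (t := t) (y := z 1) hβ hγ hρ (hm1.trans hm)
    hb (hz.roots_toFinset hβ hρ).symm (Finset.mem_image_of_mem _ (by simp))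
    (fun x hx => by
      obtain ⟨j, hj, rfl⟩ := Finset.mem_image.1 hx
      have hj := Finset.mem_Icc.1 hj
      exact hz.1.antitoneOn h1mem hj hj.1)
    (fun x hx => by
      obtain ⟨j, hj, rfl⟩ := Finset.mem_image.1 hx
      have hj' := Finset.mem_Icc.1 hj
      refine Finset.mem_erase.2 ⟨fun h => ?_, Finset.mem_image_of_mem _ (hsub hj)⟩
      have := hz.1.injOn (Finset.mem_Icc.1 (hsub hj)) h1mem h
      omega)
    (fun x hx y hy hyt => by
      obtain ⟨j, hj, rfl⟩ := Finset.mem_image.1 hx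
      obtain ⟨i, hi, rfl⟩ := Finset.mem_image.1 (Finset.mem_of_mem_erase hy)
      have hit : i ∉ Finset.Icc (m + 2) (q + 1) := fun h => hyt (Finset.mem_image_of_mem _ h)
      have hj' := Finset.mem_Icc.1 (hsub hj)
      have hi' := Finset.mem_Icc.1 hi
      refine hz.1 hi' hj' ?_
      simp only [Finset.mem_Icc] at hit hj
      omega)
    (by omega)
  rw [ht, Finset.prod_image hinj', ← ht, htc, sum_reproducingKernel] at hprod
  set L := (jacobiPoly α β γ ρ (q + 1)).leadingCoeff with hL
  have hLpos : 0 < L := jacobiPoly_leadingCoeff_pos hβ hρ _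
  have hsum := mul_left_cancel₀ (Finset.prod_ne_zero_iff.2 fun j _ => X_sub_C_ne_zero (z j))
    ((hz.eq_mul hβ hγ hρ hm).symm.trans hc)
  rw [hprod, Finset.mul_sum] at hsum
  simp only [← mul_assoc, ← C_mul] at hsum
  -- Since `⟨P_l, P_l⟩ = 1/d_l`, comparing coefficients of `P_l` cancels `d_l` and leaves `P_l(b)`
  -- times the tail.
  have hcoef : ∀ l ≤ q - m, c l / (jacobiPoly α β γ ρ l).eval b
      = L * ∑ i ∈ Finset.Ico l (q - m + 1), E i := by
    intro l hl
    have h := jacobiPoly_expansion_unique hβ hγ hρ hsum (Nat.lt_succ_of_le hl)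
    rw [← hz.roots_toFinset hβ hρ, jacobiPoly_form hβ hγ hρ q (by omega) (by omega),
      if_pos rfl, div_inv_eq_mul] at h
    have hPb := jacobiPoly_eval_pos_of_lt (l := l) hβ hγ hρ (hm1.trans hm) hb (by omega)
    have hd := jacobiNorm_pos hβ hγ hρ l
    rw [div_eq_iff hPb.ne']
    refine mul_left_cancel₀ hd.ne' ?_
    rw [← h]; ring
  constructor
  · intro l hl
    rw [hcoef l hl.le, hcoef (l + 1) hl]
    rw [Finset.sum_eq_sum_Ico_succ_bot (show l < q - m + 1 by omega)]
    have := mul_pos hLpos (hE l (by omega))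
    rw [mul_add]
    linarith
  · rw [hcoef _ le_rfl]
    simpa using mul_pos hLpos (hE (q - m) htc.ge)

/-- Both the differences of the ratios and `P_{q+1}(b)` are positive multiples of `b - y`. Relating
them by a factor `τ > 0` treats all three signs at once. -/
theorem quotient_coeff_largest_zero (hβ : ∀ l, 0 < β l) (hγ : ∀ l, 0 < γ l) (hρ : ∀ l, 0 < ρ l)
    (hq : 1 ≤ q) {b y : ℝ} (hb : ∀ r, (jacobiPoly α β γ ρ q).IsRoot r → r < b)
    (hy : (jacobiPoly α β γ ρ (q + 1)).IsRoot y)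
    (hmax : ∀ x, (jacobiPoly α β γ ρ (q + 1)).IsRoot x → x ≤ y) {c : ℕ → ℝ}
    (hc : jacobiPoly α β γ ρ (q + 1) = (X - C y) *
      ∑ l ∈ Finset.range (q + 1), C (jacobiNorm β γ ρ l * c l) * jacobiPoly α β γ ρ l) :
    (∀ l < q, ∃ τ > 0, c l / (jacobiPoly α β γ ρ l).eval b
        - c (l + 1) / (jacobiPoly α β γ ρ (l + 1)).eval b
        = τ * (jacobiPoly α β γ ρ (q + 1)).eval b) ∧
      ∀ l ≤ q, 0 < c l / (jacobiPoly α β γ ρ l).eval b := by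
  have hPb : ∀ l ≤ q, 0 < (jacobiPoly α β γ ρ l).eval b := fun l hl =>
    jacobiPoly_eval_pos_of_lt hβ hγ hρ hq hb hl
  have hPy : ∀ l ≤ q, 0 < (jacobiPoly α β γ ρ l).eval y := fun l hl =>
    jacobiPoly_eval_pos hβ hγ hρ hmax (Nat.lt_succ_of_le hl)
  have hK : ∀ l ≤ q, 0 < ∑ i ∈ Finset.range (l + 1), jacobiNorm β γ ρ i *
      ((jacobiPoly α β γ ρ i).eval b * (jacobiPoly α β γ ρ i).eval y) := fun l hl =>
    Finset.sum_pos (fun i hi => by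
      have hi := Finset.mem_range.1 hi
      exact mul_pos (jacobiNorm_pos hβ hγ hρ i) (mul_pos (hPb i (by omega)) (hPy i (by omega))))
      ⟨0, by simp⟩
  set κ := darbouxConst β γ q * (jacobiPoly α β γ ρ q).eval y with hκ
  have hκpos : 0 < κ := mul_pos (darbouxConst_pos hβ hγ q) (hPy q le_rfl)
  have hcoef : ∀ l ≤ q, c l = (jacobiPoly α β γ ρ l).eval y / κ := by
    intro l hl
    have h := jacobiPoly_christoffel_darboux_X (α := α) (ρ := ρ) hβ hγ y q
    rw [hy.eq_zero, C_0, zero_mul, sub_zero, ← mul_assoc, ← C_mul, ← hκ, hc, mul_left_comm] at h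
    have h := mul_left_cancel₀ (X_sub_C_ne_zero y) h
    rw [Finset.mul_sum] at h
    simp only [← mul_assoc, ← C_mul] at h
    have h := jacobiPoly_expansion_unique hβ hγ hρ h (Nat.lt_succ_of_le hl)
    rw [eq_div_iff hκpos.ne']
    refine mul_left_cancel₀ (jacobiNorm_pos hβ hγ hρ l).ne' ?_
    rw [h]; ring
  refine ⟨fun l hl => ?_, fun l hl => ?_⟩
  · have h1 := jacobiPoly_christoffel_darboux_real (α := α) (ρ := ρ) hβ hγ b y l
    have h2 := jacobiPoly_christoffel_darboux_real (α := α) (ρ := ρ) hβ hγ b y q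
    rw [hy.eq_zero, mul_zero, sub_zero] at h2
    have hKl := hK l hl.le
    have hKq := hK q le_rfl
    set Kl := ∑ i ∈ Finset.range (l + 1), jacobiNorm β γ ρ i *
      ((jacobiPoly α β γ ρ i).eval b * (jacobiPoly α β γ ρ i).eval y)
    set Kq := ∑ i ∈ Finset.range (q + 1), jacobiNorm β γ ρ i *
      ((jacobiPoly α β γ ρ i).eval b * (jacobiPoly α β γ ρ i).eval y)
    have hd := darbouxConst_pos hβ hγ l
    have hb0 := hPb l hl.le
    have hb1 := hPb (l + 1) hl
    have h2' : (jacobiPoly α β γ ρ (q + 1)).eval b = (b - y) * Kq / κ := by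
      rw [eq_div_iff hκpos.ne', h2, hκ]; ring
    -- This is the quotient of Christoffel–Darboux at level `l`, divided by `P_l(b) P_{l+1}(b)`, by
    -- the one at level `q`; the common factor `(b - y) / κ` drops out, so `b = y` needs no separate
    -- case.
    refine ⟨Kl / (Kq * darbouxConst β γ l * (jacobiPoly α β γ ρ l).eval b
      * (jacobiPoly α β γ ρ (l + 1)).eval b), by positivity, ?_⟩
    rw [hcoef l hl.le, hcoef (l + 1) hl, h2']
    field_simp
    linear_combination -h1
  · rw [hcoef l hl]
    exact div_pos (div_pos (hPy l hl) hκpos) (hPb l hl)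

/-! ### Absorbing `η` into the recurrence coefficients -/

theorem jacobiPoly_congr {α' : ℕ → ℝ} {n : ℕ} (h : ∀ l < n, α' l = α l) :
    ∀ l ≤ n, jacobiPoly α' β γ ρ l = jacobiPoly α β γ ρ l
  | 0, _ => rfl
  | 1, hl => by rw [jacobiPoly, jacobiPoly, h 0 hl]
  | l + 2, hl => by
    rw [jacobiPoly, jacobiPoly, h (l + 1) hl, jacobiPoly_congr h l (by omega),
      jacobiPoly_congr h (l + 1) (by omega)]

/-- The perturbation `P_{q+1} - η P_q` amounts to a change of the coefficient `α_q`. -/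
theorem perturbedPoly_eq_jacobiPoly (hβ : ∀ l, 0 < β l) (hq : 1 ≤ q) (η : ℝ) :
    perturbedPoly α β γ ρ q η
      = jacobiPoly (Function.update α q (α q + β q * η)) β γ ρ (q + 1) := by
  obtain ⟨q, rfl⟩ : ∃ k, q = k + 1 := ⟨q - 1, by omega⟩
  have hcongr := jacobiPoly_congr (α := α) (β := β) (γ := γ) (ρ := ρ)
    (α' := Function.update α (q + 1) (α (q + 1) + β (q + 1) * η)) (n := q + 1)
    (fun l hl => Function.update_of_ne hl.ne _ _)
  rw [perturbedPoly, jacobiPoly, jacobiPoly, hcongr (q + 1) le_rfl, hcongr q (by omega),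
    Function.update_self]
  have h : C (β (q + 1))⁻¹ * C (β (q + 1)) = (1 : ℝ[X]) := by
    rw [← C_mul, inv_mul_cancel₀ (hβ _).ne', C_1]
  rw [C_add, C_mul]
  linear_combination C η * jacobiPoly α β γ ρ (q + 1) * h

end zeros

theorem mainTheorem3 (α β γ ρ : ℕ → ℝ)
    (hβ : ∀ l, 0 < β l) (hγ : ∀ l, 0 < γ l) (hρ : ∀ l, 0 < ρ l)
    (q m : ℕ) (hq : 1 ≤ q) (hm : m ≤ q) (η a b ηb : ℝ)
    (hab : ∀ x : ℝ, (jacobiPoly α β γ ρ q).IsRoot x → x ∈ Set.Ioo a b)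
    (hηb : ηb = (jacobiPoly α β γ ρ (q + 1)).eval b / (jacobiPoly α β γ ρ q).eval b) :
    (∃ z : ℕ → ℝ, IsDecreasingZeros (perturbedPoly α β γ ρ q η) (q + 1) z) ∧
    ∀ z : ℕ → ℝ, IsDecreasingZeros (perturbedPoly α β γ ρ q η) (q + 1) z →
      (∃ c : ℕ → ℝ, IsQuotientExpansion α β γ ρ q m η z c) ∧
      ∀ c : ℕ → ℝ, IsQuotientExpansion α β γ ρ q m η z c →
        ((1 ≤ m ∨ (m = 0 ∧ η < ηb)) →
          (∀ l < q - m, c l / (jacobiPoly α β γ ρ l).eval b >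
              c (l + 1) / (jacobiPoly α β γ ρ (l + 1)).eval b) ∧
            c (q - m) / (jacobiPoly α β γ ρ (q - m)).eval b > 0) ∧
        (m = 0 ∧ η = ηb →
          (∀ l < q, c l / (jacobiPoly α β γ ρ l).eval b =
              c (l + 1) / (jacobiPoly α β γ ρ (l + 1)).eval b) ∧
            c q / (jacobiPoly α β γ ρ q).eval b > 0) ∧
        (m = 0 ∧ ηb < η →
          0 < c 0 / (jacobiPoly α β γ ρ 0).eval b ∧
            ∀ l < q, c l / (jacobiPoly α β γ ρ l).eval b <
              c (l + 1) / (jacobiPoly α β γ ρ (l + 1)).eval b) := by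
  set α' := Function.update α q (α q + β q * η) with hα'
  have hcongr : ∀ l ≤ q, jacobiPoly α' β γ ρ l = jacobiPoly α β γ ρ l :=
    jacobiPoly_congr fun l hl => Function.update_of_ne hl.ne _ _
  have hpert : perturbedPoly α β γ ρ q η = jacobiPoly α' β γ ρ (q + 1) :=
    perturbedPoly_eq_jacobiPoly hβ hq η
  have hb : ∀ r, (jacobiPoly α' β γ ρ q).IsRoot r → r < b := fun r hr => by
    rw [hcongr q le_rfl] at hr
    exact (hab r hr).2
  have hPb := jacobiPoly_eval_pos_of_lt hβ hγ hρ hq hb le_rfl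
  -- The trichotomy `η < η_b`, `η = η_b`, `η > η_b` becomes the sign of the modified `P_{q+1}` at
  -- `b`.
  have hsign : (jacobiPoly α' β γ ρ (q + 1)).eval b
      = (jacobiPoly α' β γ ρ q).eval b * (ηb - η) := by
    rw [← hpert, perturbedPoly, eval_sub, eval_mul, eval_C, hηb, hcongr q le_rfl, mul_sub,
      mul_div_cancel₀ _ (hcongr q le_rfl ▸ hPb).ne']
    ring
  have hexp : ∀ z c : ℕ → ℝ, IsQuotientExpansion α β γ ρ q m η z c ↔
      jacobiPoly α' β γ ρ (q + 1) = (∏ j ∈ Finset.Icc 1 (m + 1), (X - C (z j))) *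
        ∑ l ∈ Finset.range (q - m + 1),
          C (jacobiNorm β γ ρ l * c l) * jacobiPoly α' β γ ρ l := fun z c => by
    rw [IsQuotientExpansion, hpert, Finset.sum_congr rfl fun l hl => by
      rw [← hcongr l (by have := Finset.mem_range.1 hl; omega)]]
  rw [hpert]
  refine ⟨exists_isDecreasingZeros hβ hγ hρ q, fun z hz => ⟨?_, fun c hc => ?_⟩⟩
  · simp only [hexp]
    exact exists_quotient_expansion hβ hγ hρ hm hz
  rw [hexp] at hc
  have key : m = 0 → (∀ l < q, ∃ τ > 0, c l / (jacobiPoly α β γ ρ l).eval b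
        - c (l + 1) / (jacobiPoly α β γ ρ (l + 1)).eval b = τ * (ηb - η)) ∧
      ∀ l ≤ q, 0 < c l / (jacobiPoly α β γ ρ l).eval b := by
    rintro rfl
    have hroots : ∀ x, (jacobiPoly α' β γ ρ (q + 1)).IsRoot x ↔ x ∈ z '' Set.Icc 1 (q + 1) :=
      fun x => by rw [← hz.2]; rfl
    have h1 : 1 ∈ Set.Icc 1 (q + 1) := ⟨le_rfl, by omega⟩
    obtain ⟨h2, h3⟩ := quotient_coeff_largest_zero hβ hγ hρ hq hb
      ((hroots (z 1)).2 ⟨1, h1, rfl⟩) (fun x hx => by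
        obtain ⟨j, hj, rfl⟩ := (hroots x).1 hx
        exact hz.1.antitoneOn h1 hj hj.1) (by simpa using hc)
    refine ⟨fun l hl => ?_, fun l hl => hcongr l hl ▸ h3 l hl⟩
    obtain ⟨τ, hτ, h⟩ := h2 l hl
    rw [hsign, ← mul_assoc, hcongr l hl.le, hcongr (l + 1) hl] at h
    exact ⟨_, mul_pos hτ hPb, h⟩
  refine ⟨?_, ?_, ?_⟩
  · rintro (hm1 | ⟨hm0, hη⟩)
    · obtain ⟨h1, h2⟩ := quotient_coeff_strictAnti hβ hγ hρ hm1 hm hb hz hc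
      refine ⟨fun l hl => ?_, hcongr (q - m) (q.sub_le m) ▸ h2⟩
      have := h1 l hl
      rwa [hcongr l (by omega), hcongr (l + 1) (by omega)] at this
    · obtain ⟨h1, h2⟩ := key hm0
      refine ⟨fun l hl => ?_, h2 _ (q.sub_le m)⟩
      obtain ⟨τ, hτ, h⟩ := h1 l (by omega)
      have := mul_pos hτ (sub_pos.2 hη)
      linarith
  · rintro ⟨hm0, hη⟩
    obtain ⟨h1, h2⟩ := key hm0
    refine ⟨fun l hl => ?_, h2 _ le_rfl⟩
    obtain ⟨τ, hτ, h⟩ := h1 l hl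
    rw [hη, sub_self, mul_zero] at h
    linarith
  · rintro ⟨hm0, hη⟩
    obtain ⟨h1, h2⟩ := key hm0
    refine ⟨h2 0 (Nat.zero_le _), fun l hl => ?_⟩
    obtain ⟨τ, hτ, h⟩ := h1 l hl
    have := mul_neg_of_pos_of_neg hτ (sub_neg.2 hη)
    linarith
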